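/- Let $K\subset S^3$ be a knot with group $\Gamma_K=\pi_1(S^3\setminus K)$, and let $$\Gamma_K=\langle x_1,\dots,x_n \mid r_1,\dots,r_{n-1}\rangle ,\qquad n\ge 1,$$ be a Wirtinger presentation: each $r_i$ is the relator of one of the relations (I) $x_{i+1}=x_jx_ix_j^{-1}$ or (II) $x_{i+1}=x_j^{-1}x_ix_j$, where $j=j(i)$. Let $$\mathrm{AGL}_1=\left\{\begin{pmatrix}1&0\\a&t\end{pmatrix} : a\in\mathbb C,\ t\in\mathbb C^*\right\}.$$ (a) There is an isomorphism from $\Gamma_K^{ab}$ onto the infinite cyclic group $\langle t\rangle$ that sends every $x_i$ to $t$. Evaluation $\chi\mapsto\chi(x_i)$ is a bijection $\mathrm{Hom}(\Gamma_K,\mathbb C^*)\to\mathbb C^*$ that does not depend on $i$. Composing it with the projection $\mathrm{AGL}_1\to\mathbb C^*$ to the diagonal entry $t$ gives the Alexander fibration $\pi_K:\mathrm{Hom}(\Gamma_K,\mathrm{AGL}_1)\to\mathbb C^*$. Let $A_K\in M_{(n-1)\times n}(\mathbb Z[t,t^{-1}])$ be the Alexander matrix of the presentation. Its entries are the images of the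 Fox derivatives $\partial r_i/\partial x_j\in\mathbb Z[F_n]$ under the ring map $\mathbb Z[F_n]\to\mathbb Z[t,t^{-1}]$, $x_k\mapsto t$. Let $E^1_K$ be the ideal of $\mathbb Z[t,t^{-1}]$ generated by the $(n-1)\times(n-1)$ minors of $A_K$ (the unit ideal if $n=1$), and let the Alexander polynomial $\Delta_K$ be a greatest common divisor of the elements of $E^1_K$; it exists and is unique up to units $\pm t^k$. (b) For every $t\in\mathbb C^*$, sending $\rho$ to $(a_1,\dots,a_n)$, where $a_i$ is the off-diagonal entry of $\rho(x_i)$, is a bijection $$\pi_K^{-1}(t)\ \longrightarrow\ \{a\in\mathbb C^n : A_K(t)\,a=0\}.$$ (c) For every $t\in\mathbb C^*$ the following are equivalent: $\dim\ker A_K(t)\ne 1$ (that is, $t$ lies in the exceptional locus of $\pi_K$); there is a non-abelian representation $\rho:\Gamma_K\to\mathrm{AGL}_1$ with $\pi_K(\rho)=t$; $\Delta_K(t)=0$ (Burde--de Rham theorem). -/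

import Mathlib

noncomputable section

open scoped LaurentPolynomial

/-! ### Knots in the 3-sphere and their groups -/

/-- The 3-sphere. -/
abbrev S3 : Type := Metric.sphere (0 : EuclideanSpace ℝ (Fin 4)) 1

/-- A knot: an embedded circle in the 3-sphere. -/
structure Knot where
  toFun : Circle → S3
  isEmbedding : Topology.IsEmbedding toFun

namespace Knot

/-- The complement of the knot. -/
def complement (K : Knot) : Set S3 := (Set.range K.toFun)ᶜ

/-- The knot group, with base point `p`. -/
abbrev knotGroup (K : Knot) (p : K.complement) : Type := FundamentalGroup K.complement p

end Knot

/-! ### The group of affine transformations of the complex line -/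

/-- The group of invertible matrices of the form `!![1, 0; a, t]`. -/
def AGL1 : Subgroup (GL (Fin 2) ℂ) where
  carrier := {g | g 0 0 = 1 ∧ g 0 1 = 0}
  one_mem' := by simp
  mul_mem' := by
    rintro g h ⟨hg0, hg1⟩ ⟨hh0, hh1⟩
    simp [Matrix.mul_apply, Fin.sum_univ_two, hg0, hg1, hh0, hh1]
  inv_mem' := by
    rintro g ⟨h0, h1⟩
    have e : (g * g⁻¹ : GL (Fin 2) ℂ) = 1 := mul_inv_cancel g
    have e' : (g : Matrix (Fin 2) (Fin 2) ℂ) * ((g⁻¹ : GL (Fin 2) ℂ) : Matrix (Fin 2) (Fin 2) ℂ)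
        = 1 := by
      rw [← Units.val_mul, e, Units.val_one]
    have a := congrFun (congrFun e' 0) 0
    have b := congrFun (congrFun e' 0) 1
    simp only [Matrix.mul_apply, Fin.sum_univ_two, h0, h1] at a b
    constructor
    · simpa using a
    · simpa using b

namespace AGL1

/-- The projection of `!![1, 0; a, t]` to its diagonal entry `t`, see `AGL1.diag_val`. -/
def diag : AGL1 →* ℂˣ := Matrix.GeneralLinearGroup.det.comp AGL1.subtype

theorem diag_val (g : AGL1) : (diag g : ℂ) = (g : GL (Fin 2) ℂ) 1 1 := by
  obtain ⟨g, h0, h1⟩ := g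
  simp [diag, Matrix.det_fin_two, h0, h1]

/-- The off-diagonal entry `a` of `!![1, 0; a, t]`. -/
def offDiag (g : AGL1) : ℂ := (g : GL (Fin 2) ℂ) 1 0

end AGL1

/-- A representation is abelian if its image is commutative. -/
def IsAbelianRep {Γ G : Type*} [Group Γ] [Group G] (ρ : Γ →* G) : Prop :=
  ∀ g h : Γ, Commute (ρ g) (ρ h)

/-! ### Fox calculus -/

section Fox

variable {n : ℕ}

/-- The affine bijection `y ↦ ∂x_j/∂x_i + x_j y` of `ℤ[F_n]`. -/
def foxStep (i j : Fin n) : Equiv.Perm (MonoidAlgebra ℤ (FreeGroup (Fin n))) where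
  toFun y := (if i = j then 1 else 0) + MonoidAlgebra.of ℤ _ (FreeGroup.of j) * y
  invFun y := MonoidAlgebra.of ℤ _ (FreeGroup.of j)⁻¹ * (y - if i = j then 1 else 0)
  left_inv y := by
    dsimp only
    rw [add_sub_cancel_left, ← mul_assoc, ← map_mul, inv_mul_cancel, map_one, one_mul]
  right_inv y := by
    dsimp only
    rw [← mul_assoc, ← map_mul, mul_inv_cancel, map_one, one_mul, add_sub_cancel]

/-- The Fox derivative `∂w/∂x_i ∈ ℤ[F_n]` of an element `w` of the free group. It is characterised
by the rules `foxDeriv_one`, `foxDeriv_of` and `foxDeriv_mul` below. -/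
def foxDeriv (i : Fin n) (w : FreeGroup (Fin n)) : MonoidAlgebra ℤ (FreeGroup (Fin n)) :=
  FreeGroup.lift (foxStep i) w 0

theorem foxDeriv_one (i : Fin n) : foxDeriv i 1 = 0 := by
  simp [foxDeriv]

theorem foxDeriv_of (i j : Fin n) :
    foxDeriv i (FreeGroup.of j) = if i = j then 1 else 0 := by
  simp [foxDeriv, foxStep]

theorem foxStep_lift_apply (i : Fin n) (w : FreeGroup (Fin n))
    (y : MonoidAlgebra ℤ (FreeGroup (Fin n))) :
    FreeGroup.lift (foxStep i) w y = foxDeriv i w + MonoidAlgebra.of ℤ _ w * y := by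
  induction w using FreeGroup.induction_on generalizing y with
  | C1 => rw [map_one, map_one, one_mul, foxDeriv_one, zero_add, Equiv.Perm.one_apply]
  | of j => simp [foxDeriv, foxStep]
  | inv_of j _ =>
    have h : ∀ z, (foxStep i j)⁻¹ z =
        MonoidAlgebra.of ℤ _ (FreeGroup.of j)⁻¹ * (z - if i = j then 1 else 0) := fun _ => rfl
    simp only [foxDeriv, map_inv, FreeGroup.lift_apply_of, h]
    noncomm_ring
  | mul u v hu hv =>
    have hd : foxDeriv i (u * v) = FreeGroup.lift (foxStep i) u (foxDeriv i v) := by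
      simp [foxDeriv]
    rw [hd, map_mul, Equiv.Perm.mul_apply, hv, hu, hu, map_mul]
    noncomm_ring

theorem foxDeriv_mul (i : Fin n) (u v : FreeGroup (Fin n)) :
    foxDeriv i (u * v) = foxDeriv i u + MonoidAlgebra.of ℤ _ u * foxDeriv i v := by
  rw [← foxStep_lift_apply]
  simp [foxDeriv]

/-- The ring homomorphism `ℤ[F_n] → ℤ[t, t⁻¹]` sending every generator `x_i` to `t`. -/
def brace : MonoidAlgebra ℤ (FreeGroup (Fin n)) →ₐ[ℤ] ℤ[T;T⁻¹] :=
  MonoidAlgebra.lift ℤ _ _ ((Units.coeHom ℤ[T;T⁻¹]).comp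
    (FreeGroup.lift fun _ => (LaurentPolynomial.isUnit_T (R := ℤ) 1).unit))

theorem brace_of (j : Fin n) :
    brace (MonoidAlgebra.of ℤ _ (FreeGroup.of j)) = LaurentPolynomial.T 1 := by
  simp [brace]

end Fox

/-! ### Wirtinger presentations and the Alexander matrix -/

/-- The relators of a Wirtinger presentation with `n = m + 1` generators `x_0, …, x_m` (the arcs)
and `n - 1 = m` relators (the crossings, one of which is omitted). At the `i`-th crossing one
passes from the arc `x_i` to the arc `x_{i+1}` under the arc `x_{overArc i}`; the crossing is of
type I or II according to `typeI i`. -/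
structure WirtingerData (m : ℕ) where
  overArc : Fin m → Fin (m + 1)
  typeI : Fin m → Bool

namespace WirtingerData

variable {m : ℕ} (W : WirtingerData m)

/-- The relator `x_j x_i x_j⁻¹ x_{i+1}⁻¹` (type I) or `x_j⁻¹ x_i x_j x_{i+1}⁻¹` (type II). -/
def relator (i : Fin m) : FreeGroup (Fin (m + 1)) :=
  let x : Fin (m + 1) → FreeGroup (Fin (m + 1)) := FreeGroup.of
  let j := W.overArc i
  if W.typeI i then x j * x i.castSucc * (x j)⁻¹ * (x i.succ)⁻¹
  else (x j)⁻¹ * x i.castSucc * x j * (x i.succ)⁻¹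

/-- The group `⟨x_0, …, x_m | r_0, …, r_{m-1}⟩`. -/
abbrev presentedGroup : Type := PresentedGroup (Set.range W.relator)

/-- The `(n - 1) × n` Alexander matrix `({∂r_i/∂x_j})` over `ℤ[t, t⁻¹]`. -/
def alexanderMatrix : Matrix (Fin m) (Fin (m + 1)) ℤ[T;T⁻¹] :=
  Matrix.of fun i j => brace (foxDeriv j (W.relator i))

/-- The value `A(t)` of the Alexander matrix at a nonzero complex number `t`. -/
def alexanderMatrixAt (t : ℂˣ) : Matrix (Fin m) (Fin (m + 1)) ℂ :=
  W.alexanderMatrix.map (LaurentPolynomial.eval₂ (Int.castRingHom ℂ) t)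

/-- The elementary ideals: for `0 < k < n`, the ideal `E^k` is generated by the
`(n - k) × (n - k)` minors of the Alexander matrix. -/
def elementaryIdeal (k : ℕ) : Ideal ℤ[T;T⁻¹] :=
  if k = 0 then ⊥
  else if m + 1 ≤ k then ⊤
  else Ideal.span {d | ∃ (f : Fin (m + 1 - k) ↪o Fin m) (g : Fin (m + 1 - k) ↪o Fin (m + 1)),
    d = (W.alexanderMatrix.submatrix f g).det}

/-- `Δ` is an Alexander polynomial: a greatest common divisor of the elements of the first
elementary ideal (it is determined up to a unit `± t^k`). -/
def IsAlexanderPolynomial (Δ : ℤ[T;T⁻¹]) : Prop :=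
  (∀ p ∈ W.elementaryIdeal 1, Δ ∣ p) ∧
    ∀ d : ℤ[T;T⁻¹], (∀ p ∈ W.elementaryIdeal 1, d ∣ p) → d ∣ Δ

end WirtingerData

/-- A Wirtinger presentation of a group `Γ`: Wirtinger relators and an identification of the group
they present with `Γ`. -/
structure WirtingerPresentation (m : ℕ) (Γ : Type*) [Group Γ] extends WirtingerData m where
  equiv : toWirtingerData.presentedGroup ≃* Γ

namespace WirtingerPresentation

variable {m : ℕ} {Γ : Type*} [Group Γ] (P : WirtingerPresentation m Γ)

/-- The Wirtinger generators (meridians) `x_i ∈ Γ`. -/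
def gen (i : Fin (m + 1)) : Γ := P.equiv (PresentedGroup.of i)

/-- The identification `Hom(Γ, ℂˣ) → ℂˣ`: evaluation at a meridian. -/
def evalMeridian (χ : Γ →* ℂˣ) : ℂˣ := χ (P.gen 0)

/-- The Alexander fibration `Hom(Γ, AGL1) → Hom(Γ, ℂˣ) = ℂˣ`. -/
def alexanderFibration (ρ : Γ →* AGL1) : ℂˣ := P.evalMeridian (AGL1.diag.comp ρ)

/-- The coordinates `(a_0, …, a_m) ∈ ℂⁿ` of a representation `ρ`: the off-diagonal entries of the
matrices `ρ(x_i)`. -/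
def coords (ρ : Γ →* AGL1) : Fin (m + 1) → ℂ := fun i => AGL1.offDiag (ρ (P.gen i))

end WirtingerPresentation

end

/-!
The argument is purely algebraic: it uses only that the knot group has a presentation whose
relators say that `x_{i+1}` is a conjugate of `x_i`.

*Abelianization.* A homomorphism to a commutative group is constant on the generators
(`map_gen_eq`), and every value is attained (`WirtingerPresentation.lift`).

*Fibres.* A matrix `!![1, 0; a, t]` is a pair `(a, t)` with `(a, t) (b, s) = (a + t b, t s)`. This is
the rule of Fox derivatives, so the off-diagonal entry of the image of a word `w` is
`∑ k, (∂w/∂x_k)(t) a_k` (`offDiag_lift_mk`). Hence the pairs `(a_k, t)` satisfy the relations exactly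
if `A(t) a = 0`.

*Exceptional locus.* The rows of the Alexander matrix sum to zero, so its maximal minors agree up to
sign. Thus the first elementary ideal is generated by one minor, which is therefore an Alexander
polynomial (`isAlexanderPolynomial_reducedDet`). For the same reason the constant vectors lie in
`ker A(t)`; there are others exactly if that minor vanishes at `t`. For `t ≠ 1` two elements `(a, t)`
and `(b, t)` commute only if `a = b`, so the nonconstant vectors are the nonabelian representations.
For `t = 1` every representation in the fibre is abelian, and `A(1) a = 0` says that `a` is constant.
-/

noncomputable section

open scoped LaurentPolynomial

/-! ### Affine transformations -/

namespace AGL1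

/-- The matrix `!![1, 0; a, t]`. -/
def mk (a : ℂ) (t : ℂˣ) : AGL1 :=
  ⟨⟨!![1, 0; a, t], !![1, 0; -(t⁻¹ * a), t⁻¹],
      by ext i j; fin_cases i <;> fin_cases j <;> simp [Matrix.mul_apply, Fin.sum_univ_two],
      by ext i j; fin_cases i <;> fin_cases j <;> simp [Matrix.mul_apply, Fin.sum_univ_two]⟩,
    rfl, rfl⟩

@[simp]
theorem diag_mk (a : ℂ) (t : ℂˣ) : diag (mk a t) = t := by
  ext
  rw [diag_val]
  rfl

@[simp]
theorem offDiag_mk (a : ℂ) (t : ℂˣ) : offDiag (mk a t) = a :=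
  rfl

protected theorem ext {g h : AGL1} (hd : diag g = diag h) (ho : offDiag g = offDiag h) :
    g = h := by
  have hd' : (g : GL (Fin 2) ℂ) 1 1 = (h : GL (Fin 2) ℂ) 1 1 := by
    rw [← diag_val, ← diag_val, hd]
  obtain ⟨g, hg0, hg1⟩ := g
  obtain ⟨h, hh0, hh1⟩ := h
  refine Subtype.ext (Matrix.GeneralLinearGroup.ext fun i j => ?_)
  fin_cases i <;> fin_cases j
  · exact hg0.trans hh0.symm
  · exact hg1.trans hh1.symm
  · exact ho
  · exact hd'

theorem offDiag_mul (g h : AGL1) : offDiag (g * h) = offDiag g + diag g * offDiag h := by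
  rw [diag_val]
  simp [offDiag, Matrix.mul_apply, Fin.sum_univ_two, h.2.1]

@[simp]
theorem offDiag_one : offDiag 1 = 0 := by
  simp [offDiag]

theorem eq_one_iff_offDiag {g : AGL1} (hd : diag g = 1) : g = 1 ↔ offDiag g = 0 :=
  ⟨fun h => by rw [h, offDiag_one], fun h => AGL1.ext (by simp [hd]) (by simp [h])⟩

theorem commute_iff {g h : AGL1} :
    Commute g h ↔
      offDiag g + diag g * offDiag h = offDiag h + diag h * offDiag g := by
  rw [← offDiag_mul, ← offDiag_mul]
  exact ⟨fun e => congrArg offDiag e, fun e => AGL1.ext (by simp [mul_comm]) e⟩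

end AGL1

/-! ### Fox calculus at a complex number -/

section Fox

variable {n : ℕ}

theorem foxDeriv_inv (i : Fin n) (w : FreeGroup (Fin n)) :
    foxDeriv i w⁻¹ = -(MonoidAlgebra.of ℤ _ w⁻¹ * foxDeriv i w) := by
  have h := foxDeriv_mul i w⁻¹ w
  rw [inv_mul_cancel, foxDeriv_one] at h
  exact eq_neg_of_add_eq_zero_left h.symm

theorem brace_of_inv (j : Fin n) :
    brace (MonoidAlgebra.of ℤ _ (FreeGroup.of j)⁻¹) = LaurentPolynomial.T (-1) := by
  have h : brace (MonoidAlgebra.of ℤ _ (FreeGroup.of j)⁻¹) *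
      brace (MonoidAlgebra.of ℤ _ (FreeGroup.of j)) = 1 := by
    rw [← map_mul, ← map_mul, inv_mul_cancel, map_one, map_one]
  rw [brace_of] at h
  calc _ = brace (MonoidAlgebra.of ℤ _ (FreeGroup.of j)⁻¹) * LaurentPolynomial.T 1 *
      LaurentPolynomial.T (-1) := by rw [mul_assoc, ← LaurentPolynomial.T_add]; simp
    _ = _ := by rw [h, one_mul]

/-- Evaluation of a Laurent polynomial at a nonzero complex number. -/
abbrev evalAt (t : ℂˣ) : ℤ[T;T⁻¹] →+* ℂ := LaurentPolynomial.eval₂ (Int.castRingHom ℂ) t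

theorem evalAt_brace_of (t : ℂˣ) (w : FreeGroup (Fin n)) :
    evalAt t (brace (MonoidAlgebra.of ℤ _ w)) = (FreeGroup.lift (fun _ => t) w : ℂˣ) := by
  have h : ((evalAt t).toMonoidHom.comp (brace (n := n)).toRingHom.toMonoidHom).comp
      (MonoidAlgebra.of ℤ _) = (Units.coeHom ℂ).comp (FreeGroup.lift fun _ => t) := by
    refine FreeGroup.ext_hom _ _ fun j => ?_
    change evalAt t (brace (MonoidAlgebra.of ℤ _ (FreeGroup.of j))) = _
    rw [brace_of, LaurentPolynomial.eval₂_T]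
    simp
  exact DFunLike.congr_fun h w

theorem diag_lift_mk (a : Fin n → ℂ) (t : ℂˣ) (w : FreeGroup (Fin n)) :
    AGL1.diag (FreeGroup.lift (fun k => AGL1.mk (a k) t) w) = FreeGroup.lift (fun _ => t) w := by
  have h : AGL1.diag.comp (FreeGroup.lift fun k => AGL1.mk (a k) t) =
      FreeGroup.lift fun _ => t := FreeGroup.ext_hom _ _ fun j => by simp
  exact DFunLike.congr_fun h w

/-- Both sides are crossed homomorphisms in `w` that agree on the generators. -/
theorem offDiag_lift_mk (a : Fin n → ℂ) (t : ℂˣ) (w : FreeGroup (Fin n)) :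
    AGL1.offDiag (FreeGroup.lift (fun k => AGL1.mk (a k) t) w) =
      ∑ k, evalAt t (brace (foxDeriv k w)) * a k := by
  have hof (j : Fin n) : AGL1.offDiag (FreeGroup.lift (fun k => AGL1.mk (a k) t)
      (FreeGroup.of j)) = ∑ k, evalAt t (brace (foxDeriv k (FreeGroup.of j))) * a k := by
    simp [foxDeriv_of, apply_ite]
  have hmul (u v : FreeGroup (Fin n)) (k : Fin n) :
      evalAt t (brace (foxDeriv k (u * v))) = evalAt t (brace (foxDeriv k u)) +
        (FreeGroup.lift (fun _ => t) u : ℂˣ) * evalAt t (brace (foxDeriv k v)) := by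
    rw [foxDeriv_mul, map_add, map_add, map_mul, map_mul, evalAt_brace_of]
  induction w using FreeGroup.induction_on with
  | C1 => simp [foxDeriv_one]
  | of j => exact hof j
  | inv_of j _ =>
    have h1 := AGL1.offDiag_mul (FreeGroup.lift (fun k => AGL1.mk (a k) t) (FreeGroup.of j)⁻¹)
      (FreeGroup.lift (fun k => AGL1.mk (a k) t) (FreeGroup.of j))
    rw [← map_mul, inv_mul_cancel, map_one, AGL1.offDiag_one, diag_lift_mk, hof] at h1
    have h2 : ∑ k, evalAt t (brace (foxDeriv k ((FreeGroup.of j)⁻¹ * FreeGroup.of j))) * a k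
        = 0 := by simp [foxDeriv_one]
    simp only [hmul, add_mul, mul_assoc, Finset.sum_add_distrib, ← Finset.mul_sum] at h2
    linear_combination -h1 - h2
  | mul u v hu hv =>
    rw [map_mul, AGL1.offDiag_mul, diag_lift_mk, hu, hv]
    simp only [hmul, add_mul, mul_assoc, Finset.sum_add_distrib, ← Finset.mul_sum]

end Fox

/-! ### The Alexander matrix -/

namespace WirtingerData

variable {m : ℕ} (W : WirtingerData m)

theorem lift_relator_eq_one {C : Type*} [CommGroup C] (c : C) (i : Fin m) :
    FreeGroup.lift (fun _ => c) (W.relator i) = 1 := by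
  unfold relator
  cases W.typeI i <;> simp

/-- The `i`-th row is `(1 - s) x_j + s x_i - x_{i+1}` with `j = overArc i`, where `s` is `t` for
type I and `t⁻¹` for type II. -/
theorem alexanderMatrix_apply (i : Fin m) (k : Fin (m + 1)) :
    W.alexanderMatrix i k =
      (1 - LaurentPolynomial.T (if W.typeI i then 1 else -1)) *
        (if k = W.overArc i then 1 else 0) +
      LaurentPolynomial.T (if W.typeI i then 1 else -1) * (if k = i.castSucc then 1 else 0) -
      (if k = i.succ then 1 else 0) := by
  have hT : (LaurentPolynomial.T 1 : ℤ[T;T⁻¹]) * LaurentPolynomial.T (-1) = 1 := by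
    rw [← LaurentPolynomial.T_add]; simp
  have hite (j : Fin (m + 1)) : brace (n := m + 1) (if k = j then 1 else 0) =
      (if k = j then 1 else 0 : ℤ[T;T⁻¹]) := by
    split_ifs <;> simp
  simp only [alexanderMatrix, Matrix.of_apply, relator]
  cases W.typeI i <;>
    simp only [if_true, if_false, Bool.false_eq_true, foxDeriv_mul, foxDeriv_inv, foxDeriv_of,
      map_add, map_mul, map_neg, brace_of, brace_of_inv, hite]
  · linear_combination ((if k = W.overArc i then 1 else 0) -
      (if k = i.succ then 1 else 0) *
        (1 + LaurentPolynomial.T 1 * LaurentPolynomial.T (-1))) * hT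
  · linear_combination (-(if k = W.overArc i then 1 else 0) * LaurentPolynomial.T 1 -
      (if k = i.succ then 1 else 0) *
        (1 + LaurentPolynomial.T 1 * LaurentPolynomial.T (-1))) * hT

theorem sum_alexanderMatrix (i : Fin m) : ∑ k, W.alexanderMatrix i k = 0 := by
  simp [alexanderMatrix_apply, Finset.sum_add_distrib, Finset.sum_sub_distrib]

theorem alexanderMatrixAt_mulVec (t : ℂˣ) (a : Fin (m + 1) → ℂ) (i : Fin m) :
    (W.alexanderMatrixAt t).mulVec a i =
      AGL1.offDiag (FreeGroup.lift (fun k => AGL1.mk (a k) t) (W.relator i)) := by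
  rw [offDiag_lift_mk]
  rfl

theorem alexanderMatrixAt_mulVec_const (t : ℂˣ) (c : ℂ) :
    (W.alexanderMatrixAt t).mulVec (fun _ => c) = 0 := by
  ext i
  have h := congrArg (evalAt t) (W.sum_alexanderMatrix i)
  rw [map_sum, map_zero] at h
  simp only [Matrix.mulVec, dotProduct, ← Finset.sum_mul, Pi.zero_apply]
  exact mul_eq_zero_of_left h c

theorem apply_eq_of_alexanderMatrixAt_one_mulVec {a : Fin (m + 1) → ℂ}
    (ha : (W.alexanderMatrixAt 1).mulVec a = 0) (k : Fin (m + 1)) : a k = a 0 := by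
  induction k using Fin.induction with
  | zero => rfl
  | succ i ih =>
    have h := congrFun ha i
    simp only [Matrix.mulVec, dotProduct, alexanderMatrixAt, Matrix.map_apply,
      alexanderMatrix_apply] at h
    -- at `t = 1` the two contributions of `x_j`, with `j = overArc i`, cancel
    simp only [map_sub, map_add, map_mul, LaurentPolynomial.eval₂_T, one_zpow,
      Units.val_one, sub_self, zero_add, one_mul, sub_mul, Finset.sum_sub_distrib] at h
    simp only [apply_ite (LaurentPolynomial.eval₂ _ _), map_zero, map_one, ite_mul, one_mul,
      zero_mul, Finset.sum_ite_eq', Finset.mem_univ, if_true, Pi.zero_apply] at h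
    -- what is left of the row sum is `a i.castSucc - a i.succ = 0`
    rw [← ih]
    linear_combination -h

/-- The minor of the Alexander matrix that omits the `0`-th column. -/
def reducedDet : ℤ[T;T⁻¹] := (W.alexanderMatrix.submatrix id (Fin.succAbove 0)).det

theorem reducedDet_dvd_det_submatrix (f : Fin m ↪o Fin m) (g : Fin m ↪o Fin (m + 1)) :
    W.reducedDet ∣ (W.alexanderMatrix.submatrix f g).det := by
  have hf : (f : Fin m → Fin m) = id := by
    refine (f.strictMono.range_inj strictMono_id).1 ?_
    rw [Set.range_id, Set.range_eq_univ]
    exact Finite.surjective_of_injective f.injective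
  obtain ⟨j, hj⟩ : ∃ j, j ∉ Set.range g := by
    by_contra! h
    have := Fintype.card_le_of_surjective g h
    simp at this
  have hg : (g : Fin m → Fin (m + 1)) = j.succAbove := by
    refine (g.strictMono.range_inj (Fin.strictMono_succAbove j)).1 ?_
    refine Set.eq_of_subset_of_ncard_le ?_ ?_
    · rw [Fin.range_succAbove]
      rintro _ hx rfl
      exact hj hx
    · rw [← Set.image_univ, ← Set.image_univ, Set.ncard_image_of_injective _ g.injective,
        Set.ncard_image_of_injective _ Fin.succAbove_right_injective]
  rw [hf, hg, Matrix.submatrix_succAbove_det_eq_negOnePow_submatrix_succAbove_det' _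
    W.sum_alexanderMatrix j 0, Units.smul_def, zsmul_eq_mul]
  exact dvd_mul_left _ _

theorem elementaryIdeal_one : W.elementaryIdeal 1 = Ideal.span {W.reducedDet} := by
  unfold elementaryIdeal
  rw [if_neg one_ne_zero]
  split_ifs with h
  · obtain rfl : m = 0 := by omega
    simp [reducedDet]
  · refine le_antisymm (Ideal.span_le.2 ?_) (Ideal.span_mono ?_)
    · rintro _ ⟨f, g, rfl⟩
      exact Ideal.mem_span_singleton.2 (W.reducedDet_dvd_det_submatrix f g)
    · rw [Set.singleton_subset_iff]
      exact ⟨(OrderIso.refl _).toOrderEmbedding, Fin.succAboveOrderEmb 0, rfl⟩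

theorem isAlexanderPolynomial_reducedDet : W.IsAlexanderPolynomial W.reducedDet := by
  rw [IsAlexanderPolynomial, elementaryIdeal_one]
  exact ⟨fun p hp => Ideal.mem_span_singleton.1 hp,
    fun d hd => hd _ (Ideal.mem_span_singleton_self _)⟩

theorem eval_eq_zero_iff_eval_reducedDet {W : WirtingerData m} {Δ : ℤ[T;T⁻¹]}
    (h : W.IsAlexanderPolynomial Δ) (t : ℂˣ) :
    evalAt t Δ = 0 ↔ evalAt t W.reducedDet = 0 := by
  have h1 : Δ ∣ W.reducedDet :=
    h.1 _ (by rw [elementaryIdeal_one]; exact Ideal.mem_span_singleton_self _)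
  have h2 : W.reducedDet ∣ Δ := h.2 _ W.isAlexanderPolynomial_reducedDet.1
  exact ⟨fun e => zero_dvd_iff.1 (e ▸ map_dvd (evalAt t) h1),
    fun e => zero_dvd_iff.1 (e ▸ map_dvd (evalAt t) h2)⟩

/-- A vector of `ker A(t)` can be made to vanish at `0` by subtracting a constant vector; what is
left is a vector in the kernel of the square matrix that omits the `0`-th column. -/
theorem exists_mulVec_eq_zero_iff_eval_reducedDet (t : ℂˣ) :
    (∃ a, (W.alexanderMatrixAt t).mulVec a = 0 ∧ ∃ k, a k ≠ a 0) ↔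
      evalAt t W.reducedDet = 0 := by
  have hdet : evalAt t W.reducedDet =
      ((W.alexanderMatrixAt t).submatrix id Fin.succ).det := by
    rw [reducedDet, RingHom.map_det, Fin.succAbove_zero]
    rfl
  have hmul (v : Fin m → ℂ) : (W.alexanderMatrixAt t).mulVec (Fin.cons 0 v) =
      ((W.alexanderMatrixAt t).submatrix id Fin.succ).mulVec v := by
    ext i
    simp [Matrix.mulVec, dotProduct, Fin.sum_univ_succ]
  rw [hdet, ← Matrix.exists_mulVec_eq_zero_iff]
  constructor
  · rintro ⟨a, ha, k, hk⟩
    refine ⟨fun j => a j.succ - a 0, fun h => ?_, ?_⟩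
    · induction k using Fin.cases with
      | zero => exact hk rfl
      | succ j => exact hk (sub_eq_zero.1 (congrFun h j))
    · have hc : (Fin.cons 0 fun j => a j.succ - a 0 : Fin (m + 1) → ℂ) = a - fun _ => a 0 := by
        ext j
        induction j using Fin.cases <;> simp
      rw [← hmul, hc, Matrix.mulVec_sub, ha, alexanderMatrixAt_mulVec_const, sub_zero]
  · rintro ⟨v, hv, h⟩
    obtain ⟨j, hj⟩ := Function.ne_iff.1 hv
    exact ⟨Fin.cons 0 v, (hmul v).trans h, j.succ, by simpa using hj⟩

theorem finrank_ker_ne_one_iff (t : ℂˣ) :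
    Module.finrank ℂ (LinearMap.ker (W.alexanderMatrixAt t).mulVecLin) ≠ 1 ↔
      ∃ a, (W.alexanderMatrixAt t).mulVec a = 0 ∧ ∃ k, a k ≠ a 0 := by
  let e : LinearMap.ker (W.alexanderMatrixAt t).mulVecLin :=
    ⟨fun _ => 1, W.alexanderMatrixAt_mulVec_const t 1⟩
  have he : e ≠ 0 := fun h => one_ne_zero (congrFun (congrArg Subtype.val h) 0)
  rw [ne_eq, finrank_eq_one_iff_of_nonzero' e he, not_iff_comm]
  push Not
  constructor
  · rintro h ⟨a, ha⟩
    refine ⟨a 0, Subtype.ext (funext fun k => ?_)⟩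
    simpa [e] using (h a ha k).symm
  · intro h a ha k
    obtain ⟨c, hc⟩ := h ⟨a, ha⟩
    have hc' (j : Fin (m + 1)) : c = a j := by
      simpa [e] using congrFun (congrArg Subtype.val hc) j
    rw [← hc', ← hc']

end WirtingerData

/-! ### Representations of a group with a Wirtinger presentation -/

namespace WirtingerPresentation

variable {m : ℕ} {Γ : Type*} [Group Γ] (P : WirtingerPresentation m Γ)

/-- The homomorphism with prescribed values on the generators, provided these satisfy the
relations. -/
def lift {G : Type*} [Group G] (f : Fin (m + 1) → G)
    (h : ∀ i, FreeGroup.lift f (P.relator i) = 1) : Γ →* G :=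
  (PresentedGroup.toGroup (rels := Set.range P.relator) (f := f)
    (by rintro _ ⟨i, rfl⟩; exact h i)).comp P.equiv.symm.toMonoidHom

@[simp]
theorem lift_gen {G : Type*} [Group G] (f : Fin (m + 1) → G)
    (h : ∀ i, FreeGroup.lift f (P.relator i) = 1) (i : Fin (m + 1)) :
    P.lift f h (P.gen i) = f i := by
  simp [lift, gen]

theorem hom_ext {G : Type*} [Group G] {f g : Γ →* G} (h : ∀ i, f (P.gen i) = g (P.gen i)) :
    f = g := by
  have h' : f.comp P.equiv.toMonoidHom = g.comp P.equiv.toMonoidHom :=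
    PresentedGroup.ext fun i => h i
  ext x
  simpa using DFunLike.congr_fun h' (P.equiv.symm x)

theorem lift_relator {G : Type*} [Group G] (f : Γ →* G) (i : Fin m) :
    FreeGroup.lift (fun k => f (P.gen k)) (P.relator i) = 1 := by
  have h : FreeGroup.lift (fun k => f (P.gen k)) =
      (f.comp P.equiv.toMonoidHom).comp (PresentedGroup.mk (Set.range P.relator)) :=
    FreeGroup.ext_hom _ _ fun k => by simp [gen, PresentedGroup.of]
  rw [h, MonoidHom.comp_apply, PresentedGroup.one_of_mem (Set.mem_range_self i), map_one]

theorem map_gen_eq {C : Type*} [CommGroup C] (f : Γ →* C) (k : Fin (m + 1)) :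
    f (P.gen k) = f (P.gen 0) := by
  induction k using Fin.induction with
  | zero => rfl
  | succ i ih =>
    rw [← ih]
    have h := P.lift_relator f i
    unfold WirtingerData.relator at h
    -- up to commutativity both types of relator say `x_i x_{i+1}⁻¹ = 1`
    cases hT : P.typeI i <;> simp [hT, mul_inv_eq_one] at h <;> exact h.symm

theorem exists_hom_comm {C : Type*} [CommGroup C] (c : C) : ∃ f : Γ →* C, ∀ i, f (P.gen i) = c :=
  ⟨P.lift (fun _ => c) (P.lift_relator_eq_one c), fun i => P.lift_gen _ _ i⟩

theorem exists_abelianization_equiv : ∃ H : Abelianization Γ ≃* Multiplicative ℤ,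
    ∀ i, H (Abelianization.of (P.gen i)) = Multiplicative.ofAdd 1 := by
  obtain ⟨f, hf⟩ := P.exists_hom_comm (Multiplicative.ofAdd (1 : ℤ))
  refine ⟨MulEquiv.ofBijective (Abelianization.lift f) ?_,
    fun i => (Abelianization.lift_apply_of f _).trans (hf i)⟩
  refine Function.bijective_iff_has_inverse.2
    ⟨zpowersHom _ (Abelianization.of (P.gen 0)), ?_, fun z => ?_⟩
  · have h : (zpowersHom _ (Abelianization.of (P.gen 0))).comp (Abelianization.lift f) =
        MonoidHom.id _ := by
      refine Abelianization.hom_ext _ _ (P.hom_ext fun i => ?_)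
      simp [hf, P.map_gen_eq Abelianization.of i]
    exact DFunLike.congr_fun h
  · rw [zpowersHom_apply, map_zpow, Abelianization.lift_apply_of, hf, ← ofAdd_zsmul]
    simp

theorem evalMeridian_bijective : Function.Bijective P.evalMeridian := by
  constructor
  · intro χ ψ h
    refine P.hom_ext fun i => ?_
    rw [P.map_gen_eq χ, P.map_gen_eq ψ]
    exact h
  · intro t
    obtain ⟨f, hf⟩ := P.exists_hom_comm t
    exact ⟨f, hf 0⟩

theorem diag_gen {ρ : Γ →* AGL1} {t : ℂˣ} (h : P.alexanderFibration ρ = t) (i : Fin (m + 1)) :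
    AGL1.diag (ρ (P.gen i)) = t := by
  rw [← h]
  exact P.map_gen_eq (AGL1.diag.comp ρ) i

theorem map_gen_eq_mk {ρ : Γ →* AGL1} {t : ℂˣ} (h : P.alexanderFibration ρ = t)
    (i : Fin (m + 1)) : ρ (P.gen i) = AGL1.mk (P.coords ρ i) t :=
  AGL1.ext (by simp [P.diag_gen h]) (by simp [coords])

theorem bijOn_coords (t : ℂˣ) : Set.BijOn P.coords (P.alexanderFibration ⁻¹' {t})
    {a : Fin (m + 1) → ℂ | (P.alexanderMatrixAt t).mulVec a = 0} := by
  refine ⟨fun ρ hρ => ?_, fun ρ hρ σ hσ h => ?_, fun a ha => ?_⟩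
  · ext i
    rw [P.alexanderMatrixAt_mulVec]
    simp only [← P.map_gen_eq_mk hρ, P.lift_relator, AGL1.offDiag_one, Pi.zero_apply]
  · refine P.hom_ext fun i => ?_
    rw [P.map_gen_eq_mk hρ, P.map_gen_eq_mk hσ, h]
  · refine ⟨P.lift (fun k => AGL1.mk (a k) t) fun i => ?_, ?_, ?_⟩
    · rw [AGL1.eq_one_iff_offDiag, ← P.alexanderMatrixAt_mulVec]
      · exact congrFun ha i
      · rw [diag_lift_mk, P.lift_relator_eq_one]
    · simp [alexanderFibration, evalMeridian]
    · ext i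
      simp [coords]

theorem isAbelianRep_of_forall_gen {G : Type*} [Group G] {ρ : Γ →* G}
    (h : ∀ i j, Commute (ρ (P.gen i)) (ρ (P.gen j))) : IsAbelianRep ρ := by
  have key (x : G) (hx : ∀ i, Commute (ρ (P.gen i)) x) (g : Γ) : Commute (ρ g) x := by
    have hg := PresentedGroup.generated_by (Set.range P.relator)
      ((Subgroup.centralizer {x}).comap (ρ.comp P.equiv.toMonoidHom))
      (fun i => Subgroup.mem_centralizer_singleton_iff.2 (hx i)) (P.equiv.symm g)
    have := Subgroup.mem_centralizer_singleton_iff.1 (Subgroup.mem_comap.1 hg)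
    simpa [Commute, SemiconjBy] using this
  exact fun g g' => key _ (fun i => (key _ (fun j => h j i) g').symm) g

theorem isAbelianRep_iff {ρ : Γ →* AGL1} {t : ℂˣ} (h : P.alexanderFibration ρ = t) :
    IsAbelianRep ρ ↔ ∀ k, P.coords ρ k = P.coords ρ 0 := by
  constructor
  · intro hab k
    by_cases ht : t = 1
    · have hker := (P.bijOn_coords t).mapsTo h
      rw [ht] at hker
      exact P.apply_eq_of_alexanderMatrixAt_one_mulVec hker k
    · have hc := AGL1.commute_iff.1 (hab (P.gen k) (P.gen 0))
      rw [P.diag_gen h, P.diag_gen h] at hc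
      have ht' : (1 - t : ℂ) ≠ 0 := sub_ne_zero.2 fun e => ht (Units.ext e.symm)
      refine mul_left_cancel₀ ht' ?_
      simp only [coords]
      linear_combination hc
  · intro hc
    refine P.isAbelianRep_of_forall_gen fun i j => ?_
    rw [P.map_gen_eq_mk h, P.map_gen_eq_mk h, hc i, hc j]
    exact Commute.refl _

theorem exists_not_isAbelianRep_iff (t : ℂˣ) :
    (∃ ρ : Γ →* AGL1, P.alexanderFibration ρ = t ∧ ¬ IsAbelianRep ρ) ↔
      ∃ a, (P.alexanderMatrixAt t).mulVec a = 0 ∧ ∃ k, a k ≠ a 0 := by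
  constructor
  · rintro ⟨ρ, hρ, h⟩
    rw [P.isAbelianRep_iff hρ] at h
    push Not at h
    exact ⟨P.coords ρ, (P.bijOn_coords t).mapsTo hρ, h⟩
  · rintro ⟨a, ha, k, hk⟩
    obtain ⟨ρ, hρ, rfl⟩ := (P.bijOn_coords t).surjOn ha
    exact ⟨ρ, hρ, fun h => hk ((P.isAbelianRep_iff hρ).1 h k)⟩

end WirtingerPresentation

end

theorem mainTheorem4 (K : Knot) (p : K.complement) {m : ℕ}
    (P : WirtingerPresentation m (K.knotGroup p)) :
    -- the abelianization is infinite cyclic, generated by the common class `t` of the meridians;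
    -- `Hom(Γ_K, ℂˣ)` is thereby identified with `ℂˣ` by evaluation at any meridian
    (∃ H : Abelianization (K.knotGroup p) ≃* Multiplicative ℤ,
      ∀ i, H (Abelianization.of (P.gen i)) = Multiplicative.ofAdd 1) ∧
    Function.Bijective P.evalMeridian ∧
    (∀ (χ : K.knotGroup p →* ℂˣ) (i : Fin (m + 1)), χ (P.gen i) = P.evalMeridian χ) ∧
    -- the fibre over `t` is the kernel of `A_K(t)`
    (∀ t : ℂˣ, Set.BijOn P.coords (P.alexanderFibration ⁻¹' {t})
      {a : Fin (m + 1) → ℂ | (P.alexanderMatrixAt t).mulVec a = 0}) ∧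
    -- the exceptional locus, and the Burde–de Rham theorem
    (∃ Δ : LaurentPolynomial ℤ, P.IsAlexanderPolynomial Δ) ∧
    ∀ Δ : LaurentPolynomial ℤ, P.IsAlexanderPolynomial Δ → ∀ t : ℂˣ,
      (Module.finrank ℂ (LinearMap.ker (P.alexanderMatrixAt t).mulVecLin) ≠ 1 ↔
        LaurentPolynomial.eval₂ (Int.castRingHom ℂ) t Δ = 0) ∧
      ((∃ ρ : K.knotGroup p →* AGL1, P.alexanderFibration ρ = t ∧ ¬ IsAbelianRep ρ) ↔
        LaurentPolynomial.eval₂ (Int.castRingHom ℂ) t Δ = 0) := by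
  refine ⟨P.exists_abelianization_equiv, P.evalMeridian_bijective, fun χ i => P.map_gen_eq χ i,
    P.bijOn_coords, ⟨_, P.isAlexanderPolynomial_reducedDet⟩, fun Δ hΔ t => ?_⟩
  rw [WirtingerData.eval_eq_zero_iff_eval_reducedDet hΔ, P.finrank_ker_ne_one_iff,
    P.exists_not_isAbelianRep_iff, P.exists_mulVec_eq_zero_iff_eval_reducedDet]
  exact ⟨Iff.rfl, Iff.rfl⟩
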